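/- **Theorem (Decidability of $\mathsf{qG}$).** Fix a countably infinite set of variables $\mathbf{Var}=\{p_0,p_1,\dots\}$ and let formulas be generated by $$\alpha ::= p \mid \alpha\cdot\beta \mid \alpha\backslash\beta \mid \alpha\wedge\beta \mid \alpha\vee\beta \mid \neg\alpha \qquad (p\in\mathbf{Var}).$$ A sequent is an expression $\alpha\Rightarrow\beta$ with $\alpha,\beta$ formulas. Let $\mathsf{qG}$ be the following sequent calculus for commutative residuated lattice-ordered semigroups (no unit is assumed) with quasi-involutive negation. Axioms: $\alpha\Rightarrow\alpha$; $\;(\alpha\cdot\beta)\cdot\gamma\Rightarrow\alpha\cdot(\beta\cdot\gamma)$; $\;\alpha\cdot(\beta\cdot\gamma)\Rightarrow(\alpha\cdot\beta)\cdot\gamma$; $\;\alpha\cdot\beta\Rightarrow\beta\cdot\alpha$. Rules: * from $\alpha\cdot\beta\Rightarrow\gamma$ infer $\beta\Rightarrow\alpha\backslash\gamma$, and from $\beta\Rightarrow\alpha\backslash\gamma$ infer $\alpha\cdot\beta\Rightarrow\gamma$; * from $\alpha\Rightarrow\beta$ infer $\alpha\wedge\gamma\Rightarrow\beta$ and $\gamma\wedge\alpha\Rightarrow\beta$;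 from $\alpha\Rightarrow\beta$ and $\alpha\Rightarrow\gamma$ infer $\alpha\Rightarrow\beta\wedge\gamma$; * from $\alpha\Rightarrow\beta$ and $\gamma\Rightarrow\beta$ infer $\alpha\vee\gamma\Rightarrow\beta$; from $\alpha\Rightarrow\beta$ infer $\alpha\Rightarrow\beta\vee\gamma$ and $\alpha\Rightarrow\gamma\vee\beta$; * from $\alpha\cdot\beta\Rightarrow\neg\gamma$ infer $\gamma\cdot\beta\Rightarrow\neg\alpha$, where $\beta$ may be absent, i.e. also from $\alpha\Rightarrow\neg\gamma$ infer $\gamma\Rightarrow\neg\alpha$; * (Cut) from $\alpha\Rightarrow\beta$ and $\beta\Rightarrow\gamma$ infer $\alpha\Rightarrow\gamma$. Then $\mathsf{qG}$ is decidable: there is an algorithm (a total computable function, formulas being coded by natural numbers through a standard effective Gödel numbering) which, given any sequent $\alpha\Rightarrow\beta$, decides whether $\alpha\Rightarrow\beta$ is derivable in $\mathsf{qG}$. -/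

import Mathlib

/-- Formulas over a countably infinite set of variables: fusion `α · β`, residual `α \ β`,
meet, join and negation. -/
inductive Formula : Type where
  | var : ℕ → Formula
  | neg : Formula → Formula
  | fus : Formula → Formula → Formula
  | res : Formula → Formula → Formula
  | meet : Formula → Formula → Formula
  | join : Formula → Formula → Formula
  deriving DecidableEq

namespace Formula

/-- The Gödel number of a formula: the constructor is the remainder modulo 6, the arguments
(paired by `Nat.pair` for binary connectives) are the quotient. -/
def toNat : Formula → ℕ
  | var n => 6 * n
  | neg a => 6 * a.toNat + 1
  | fus a b => 6 * Nat.pair a.toNat b.toNat + 2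
  | res a b => 6 * Nat.pair a.toNat b.toNat + 3
  | meet a b => 6 * Nat.pair a.toNat b.toNat + 4
  | join a b => 6 * Nat.pair a.toNat b.toNat + 5

/-- The formula with a given Gödel number. -/
def ofNat (n : ℕ) : Formula :=
  if _h0 : n % 6 = 0 then var (n / 6)
  else
    have _h : n / 6 < n := by omega
    have _hl : (Nat.unpair (n / 6)).1 < n := lt_of_le_of_lt (Nat.unpair_left_le _) _h
    have _hr : (Nat.unpair (n / 6)).2 < n := lt_of_le_of_lt (Nat.unpair_right_le _) _h
    if n % 6 = 1 then neg (ofNat (n / 6))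
    else if n % 6 = 2 then fus (ofNat (Nat.unpair (n / 6)).1) (ofNat (Nat.unpair (n / 6)).2)
    else if n % 6 = 3 then res (ofNat (Nat.unpair (n / 6)).1) (ofNat (Nat.unpair (n / 6)).2)
    else if n % 6 = 4 then meet (ofNat (Nat.unpair (n / 6)).1) (ofNat (Nat.unpair (n / 6)).2)
    else join (ofNat (Nat.unpair (n / 6)).1) (ofNat (Nat.unpair (n / 6)).2)
termination_by n

theorem ofNat_toNat (a : Formula) : ofNat a.toNat = a := by
  induction a with
  | var n => rw [toNat, ofNat]; simp
  | neg a ih =>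
    have h1 : (6 * a.toNat + 1) % 6 = 1 := by omega
    have h2 : (6 * a.toNat + 1) / 6 = a.toNat := by omega
    rw [toNat, ofNat]; simp [h1, h2, ih]
  | fus a b iha ihb =>
    have h1 : (6 * Nat.pair a.toNat b.toNat + 2) % 6 = 2 := by omega
    have h2 : (6 * Nat.pair a.toNat b.toNat + 2) / 6 = Nat.pair a.toNat b.toNat := by omega
    rw [toNat, ofNat]; simp [h1, h2, iha, ihb]
  | res a b iha ihb =>
    have h1 : (6 * Nat.pair a.toNat b.toNat + 3) % 6 = 3 := by omega
    have h2 : (6 * Nat.pair a.toNat b.toNat + 3) / 6 = Nat.pair a.toNat b.toNat := by omega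
    rw [toNat, ofNat]; simp [h1, h2, iha, ihb]
  | meet a b iha ihb =>
    have h1 : (6 * Nat.pair a.toNat b.toNat + 4) % 6 = 4 := by omega
    have h2 : (6 * Nat.pair a.toNat b.toNat + 4) / 6 = Nat.pair a.toNat b.toNat := by omega
    rw [toNat, ofNat]; simp [h1, h2, iha, ihb]
  | join a b iha ihb =>
    have h1 : (6 * Nat.pair a.toNat b.toNat + 5) % 6 = 5 := by omega
    have h2 : (6 * Nat.pair a.toNat b.toNat + 5) / 6 = Nat.pair a.toNat b.toNat := by omega
    rw [toNat, ofNat]; simp [h1, h2, iha, ihb]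

theorem toNat_ofNat (n : ℕ) : (ofNat n).toNat = n := by
  induction n using Nat.strong_induction_on with
  | _ n ih =>
    rw [ofNat]
    by_cases h0 : n % 6 = 0
    · simp only [h0, ↓reduceDIte, toNat]; omega
    · have h : n / 6 < n := by omega
      have hl := ih _ (lt_of_le_of_lt (Nat.unpair_left_le (n / 6)) h)
      have hr := ih _ (lt_of_le_of_lt (Nat.unpair_right_le (n / 6)) h)
      have hn := ih _ h
      simp only [h0, ↓reduceDIte]
      split_ifs <;> simp only [toNat, hl, hr, hn, Nat.pair_unpair] <;> omega

/-- Gödel numbering as a bijection between formulas and natural numbers. -/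
def equivNat : Formula ≃ ℕ := ⟨toNat, ofNat, ofNat_toNat, toNat_ofNat⟩

instance : Primcodable Formula := Primcodable.ofEquiv ℕ equivNat

end Formula

open Formula in
/-- `QG α β` says that the simple sequent `α ⇒ β` is derivable in the calculus qG for commutative
residuated lattice-ordered semigroups with quasi-involutive negation. The fusion is associative and
commutative (`assoc₁`, `assoc₂`, `comm`), the left meet rule applies to either conjunct and the
right join rule to either disjunct. The rule `mn` is the rule `smn` with an empty second factor;
there is no axiom `¬¬α ⇒ α`. -/
inductive QG : Formula → Formula → Prop where
  | id (α : Formula) : QG α α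
  | assoc₁ (α β γ : Formula) : QG (fus (fus α β) γ) (fus α (fus β γ))
  | assoc₂ (α β γ : Formula) : QG (fus α (fus β γ)) (fus (fus α β) γ)
  | comm (α β : Formula) : QG (fus α β) (fus β α)
  | res_intro {α β γ : Formula} : QG (fus α β) γ → QG β (res α γ)
  | res_elim {α β γ : Formula} : QG β (res α γ) → QG (fus α β) γ
  | meet_left₁ {α β γ : Formula} : QG α β → QG (meet α γ) β
  | meet_left₂ {α β γ : Formula} : QG α β → QG (meet γ α) β
  | meet_right {α β γ : Formula} : QG α β → QG α γ → QG α (meet β γ)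
  | join_left {α β γ : Formula} : QG α β → QG γ β → QG (join α γ) β
  | join_right₁ {α β γ : Formula} : QG α β → QG α (join β γ)
  | join_right₂ {α β γ : Formula} : QG α β → QG α (join γ β)
  | smn {α β γ : Formula} : QG (fus α β) (neg γ) → QG (fus γ β) (neg α)
  | mn {α γ : Formula} : QG α (neg γ) → QG γ (neg α)
  | cut {α β γ : Formula} : QG α β → QG β γ → QG α γ

open Formula

/-! The calculus is equivalent to a cut-free sequent calculus without contraction, in which every
premise is smaller than its conclusion, so exhaustive backward search terminates. The cut-free
system `Entails` has multiset antecedents, which absorb associativity and commutativity, and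
possibly empty succedents, which give negation its own left and right rules. Soundness
(`QG.holds_of_entails`) evaluates antecedents in the Lindenbaum semigroup with a unit adjoined. A
sequent without succedent means that one antecedent may be moved to the right under a negation; the
contraposition rules make the choice irrelevant. Completeness, which is cut elimination, is
semantic. Formulas are read as closed sets of antecedents. Derivability in `QG` implies inclusion of
these sets (`Entails.sem_mono`), and every formula `a` satisfies `{a} ∈ sem a ⊆ {Γ | Entails Γ (some
a)}` (`Entails.sem_adequate`). For decidability, rules are applied backwards to lists. The sum of
Gödel numbers drops in each of the at most two premises, so a search with a bound computed from the
sequent decides derivability (`ProofSearch.derivable_iff`), and each ingredient is primitive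
recursive. -/

/-- Cut-free sequents with a multiset of antecedents. An empty succedent expresses that the
antecedents, of which there are then at least two, are jointly inconsistent. -/
inductive Entails : Multiset Formula → Option Formula → Prop where
  | id (a : Formula) : Entails {a} (some a)
  | fus_right {Γ Δ : Multiset Formula} {a b : Formula} :
      Entails Γ (some a) → Entails Δ (some b) → Entails (Γ + Δ) (some (fus a b))
  | fus_left {Γ : Multiset Formula} {a b : Formula} {o : Option Formula} :
      -- Without this condition `a, b ⇒` would yield `a · b ⇒`, with one antecedent and no
      -- succedent, which has no counterpart in the calculus.
      ¬(Γ = 0 ∧ o = none) → Entails (a ::ₘ b ::ₘ Γ) o → Entails (fus a b ::ₘ Γ) o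
  | res_right {Γ : Multiset Formula} {a b : Formula} :
      -- There is no unit, so `a ⇒ b` must not yield a sequent with empty antecedent.
      Γ ≠ 0 → Entails (a ::ₘ Γ) (some b) → Entails Γ (some (res a b))
  | res_left {Γ Δ : Multiset Formula} {a b : Formula} {o : Option Formula} :
      Entails Γ (some a) → Entails (b ::ₘ Δ) o → Entails (res a b ::ₘ (Γ + Δ)) o
  | meet_right {Γ : Multiset Formula} {a b : Formula} :
      Entails Γ (some a) → Entails Γ (some b) → Entails Γ (some (meet a b))
  | meet_left₁ {Γ : Multiset Formula} {a b : Formula} {o : Option Formula} :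
      Entails (a ::ₘ Γ) o → Entails (meet a b ::ₘ Γ) o
  | meet_left₂ {Γ : Multiset Formula} {a b : Formula} {o : Option Formula} :
      Entails (b ::ₘ Γ) o → Entails (meet a b ::ₘ Γ) o
  | join_right₁ {Γ : Multiset Formula} {a b : Formula} :
      Entails Γ (some a) → Entails Γ (some (join a b))
  | join_right₂ {Γ : Multiset Formula} {a b : Formula} :
      Entails Γ (some b) → Entails Γ (some (join a b))
  | join_left {Γ : Multiset Formula} {a b : Formula} {o : Option Formula} :
      Entails (a ::ₘ Γ) o → Entails (b ::ₘ Γ) o → Entails (join a b ::ₘ Γ) o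
  | neg_right {Γ : Multiset Formula} {a : Formula} :
      Entails (a ::ₘ Γ) none → Entails Γ (some (neg a))
  | neg_left {Γ : Multiset Formula} {a : Formula} :
      Entails Γ (some a) → Entails (neg a ::ₘ Γ) none

/-! ### Soundness -/

namespace QG

theorem fus_mono {a b c d : Formula} (h₁ : QG a b) (h₂ : QG c d) : QG (fus a c) (fus b d) := by
  have right {x y z : Formula} (h : QG y z) : QG (fus x y) (fus x z) :=
    res_elim (h.cut (res_intro (id _)))
  exact (right h₂).cut ((comm _ _).cut ((right h₁).cut (comm _ _)))

theorem fus_res (a b : Formula) : QG (fus a (res a b)) b := res_elim (id _)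

theorem le_neg_neg (a : Formula) : QG a (neg (neg a)) := mn (id _)

/-- Fusion with a fixed formula has a residual, hence preserves joins. -/
theorem fus_join (a b c : Formula) :
    QG (fus (join a b) c) (join (fus a c) (fus b c)) := by
  refine (comm _ _).cut (res_elim (join_left (res_intro ?_) (res_intro ?_)))
  · exact (comm _ _).cut (join_right₁ (id _))
  · exact (comm _ _).cut (join_right₂ (id _))

/-! ### The Lindenbaum semigroup with a unit for empty contexts -/

/-- Interderivability of formulas. -/
def setoid : Setoid Formula where
  r a b := QG a b ∧ QG b a
  iseqv := ⟨fun a => ⟨id a, id a⟩, fun h => ⟨h.2, h.1⟩,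
    fun h k => ⟨h.1.cut k.1, k.2.cut h.2⟩⟩

/-- The Lindenbaum algebra of `QG`. -/
def Lindenbaum : Type := Quotient setoid

instance : CommSemigroup Lindenbaum where
  mul := Quotient.map₂ fus fun _ _ h _ _ k => ⟨fus_mono h.1 k.1, fus_mono h.2 k.2⟩
  mul_assoc := by
    rintro ⟨a⟩ ⟨b⟩ ⟨c⟩
    exact Quotient.sound ⟨assoc₁ a b c, assoc₂ a b c⟩
  mul_comm := by
    rintro ⟨a⟩ ⟨b⟩
    exact Quotient.sound ⟨comm a b, comm b a⟩

/-- The class of a formula in the Lindenbaum algebra with a unit adjoined. -/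
def cls (a : Formula) : WithOne Lindenbaum :=
  ((show Lindenbaum from Quotient.mk setoid a) : WithOne Lindenbaum)

theorem cls_fus (a b : Formula) : cls (fus a b) = cls a * cls b := rfl

theorem cls_eq {a b : Formula} : cls a = cls b ↔ QG a b ∧ QG b a :=
  WithOne.coe_inj.trans (Quotient.eq (r := setoid))

theorem eq_one_or_cls (u : WithOne Lindenbaum) : u = 1 ∨ ∃ a, u = cls a := by
  refine WithOne.cases_on u (Or.inl rfl) fun x => Or.inr ?_
  exact Quotient.inductionOn x fun a => ⟨a, rfl⟩

/-- The element `u` is a class of formulas that derive `c`. -/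
def Below (u : WithOne Lindenbaum) (c : Formula) : Prop := ∃ a, u = cls a ∧ QG a c

theorem below_cls {a c : Formula} : Below (cls a) c ↔ QG a c :=
  ⟨fun ⟨_, h, k⟩ => (cls_eq.1 h).1.cut k, fun h => ⟨a, rfl, h⟩⟩

theorem Below.trans {u : WithOne Lindenbaum} {b c : Formula} (h : Below u b) (k : QG b c) :
    Below u c := by
  obtain ⟨a, rfl, h⟩ := h
  exact ⟨a, rfl, h.cut k⟩

theorem Below.mul {u v : WithOne Lindenbaum} {b c : Formula} (h : Below u b) (k : Below v c) :
    Below (u * v) (fus b c) := by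
  obtain ⟨a, rfl, h⟩ := h
  obtain ⟨d, rfl, k⟩ := k
  exact ⟨fus a d, rfl, fus_mono h k⟩

/-- This is cut under a context `v`. The adjoined unit is not the class of a formula, so an empty
context is a separate case. -/
theorem Below.subst {u v : WithOne Lindenbaum} {b c : Formula} (h : Below u b)
    (k : Below (cls b * v) c) : Below (u * v) c := by
  obtain rfl | ⟨a, rfl⟩ := eq_one_or_cls v
  · rw [mul_one] at *
    exact h.trans (below_cls.1 k)
  · exact (h.mul (below_cls.2 (id a))).trans (below_cls.1 k)

theorem Below.join {v : WithOne Lindenbaum} {a b c : Formula} (h : Below (cls a * v) c)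
    (k : Below (cls b * v) c) : Below (cls (join a b) * v) c := by
  obtain rfl | ⟨d, rfl⟩ := eq_one_or_cls v
  · simp only [mul_one, below_cls] at *
    exact join_left h k
  · simp only [← cls_fus, below_cls] at *
    exact (fus_join a b d).cut (join_left h k)

/-- Adjoining a unit unifies the two contraposition rules: `mn` is the case `v = 1` and `smn` the
case where `v` is a class. -/
theorem Below.neg_swap {v : WithOne Lindenbaum} {a b : Formula} (h : Below (cls a * v) (neg b)) :
    Below (cls b * v) (neg a) := by
  obtain rfl | ⟨d, rfl⟩ := eq_one_or_cls v
  · simp only [mul_one, below_cls] at *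
    exact mn h
  · simp only [← cls_fus, below_cls] at *
    exact smn h

/-- The product of the classes of the members of a multiset. -/
def prod (Γ : Multiset Formula) : WithOne Lindenbaum := (Γ.map cls).prod

theorem prod_cons (a : Formula) (Γ : Multiset Formula) : prod (a ::ₘ Γ) = cls a * prod Γ := by
  simp [prod]

theorem prod_add (Γ Δ : Multiset Formula) : prod (Γ + Δ) = prod Γ * prod Δ := by
  simp [prod]

theorem prod_singleton (a : Formula) : prod {a} = cls a := by simp [prod]

/-- This makes the meaning of an empty succedent independent of the antecedent that is moved to the
right. -/
theorem Below.exchange {Γ Δ : Multiset Formula} {a b : Formula} (h : Below (prod Γ) (neg a))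
    (e : a ::ₘ Γ = b ::ₘ Δ) : Below (prod Δ) (neg b) := by
  obtain ⟨rfl, rfl⟩ | ⟨-, E, rfl, rfl⟩ := Multiset.cons_eq_cons.1 e
  · exact h
  · rw [prod_cons] at *
    exact h.neg_swap

/-! ### Validity of the cut-free rules -/

/-- The interpretation of sequents in the Lindenbaum algebra. -/
def Holds (Γ : Multiset Formula) : Option Formula → Prop
  | some c => Below (prod Γ) c
  | none => ∃ a Δ, Γ = a ::ₘ Δ ∧ Below (prod Δ) (neg a)

theorem holds_none_cons {a : Formula} {Γ : Multiset Formula} :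
    Holds (a ::ₘ Γ) none ↔ Below (prod Γ) (neg a) :=
  ⟨fun ⟨_, _, e, h⟩ => h.exchange e.symm, fun h => ⟨a, Γ, rfl, h⟩⟩

theorem not_below_zero (c : Formula) : ¬ Below (prod 0) c := by
  rintro ⟨a, h, -⟩
  simp only [prod, Multiset.map_zero, Multiset.prod_zero] at h
  exact WithOne.one_ne_coe h

theorem Holds.ne_zero {Γ : Multiset Formula} {c : Formula} (h : Holds Γ (some c)) : Γ ≠ 0 := by
  rintro rfl
  exact not_below_zero c h

/-- A left rule is sound as soon as it is sound for sequents with a succedent. -/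
theorem holds_left {a : Formula} {Δ : Multiset Formula} {o : Option Formula}
    (hΔ : ¬(Δ = 0 ∧ o = none))
    (H : ∀ E c, (o = some c ∧ Δ = E ∨ o = none ∧ ∃ b, Δ = b ::ₘ E ∧ c = neg b) →
      Below (cls a * prod E) c) : Holds (a ::ₘ Δ) o := by
  cases o with
  | some c => simpa [Holds, prod_cons] using H Δ c (Or.inl ⟨rfl, rfl⟩)
  | none =>
    -- The principal formula `a` has to stay on the left, so a side formula is moved to the right.
    obtain ⟨b, hb⟩ := Multiset.exists_mem_of_ne_zero fun h => hΔ ⟨h, rfl⟩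
    obtain ⟨E, rfl⟩ := Multiset.exists_cons_of_mem hb
    rw [Multiset.cons_swap, holds_none_cons, prod_cons]
    exact H E _ (Or.inr ⟨rfl, b, rfl, rfl⟩)

/-- This prepares the premises of a left rule for `holds_left`: the alternative in `H` is the same,
so premise and conclusion move the same side formula `b`, while the active formulas `Γ` stay on the
left. -/
theorem Holds.below {Γ Δ E : Multiset Formula} {o : Option Formula} {c : Formula}
    (h : Holds (Γ + Δ) o)
    (H : o = some c ∧ Δ = E ∨ o = none ∧ ∃ b, Δ = b ::ₘ E ∧ c = neg b) :
    Below (prod Γ * prod E) c := by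
  obtain ⟨rfl, rfl⟩ | ⟨rfl, b, rfl, rfl⟩ := H
  · simpa [Holds, prod_add] using h
  · rwa [Multiset.add_cons, holds_none_cons, prod_add] at h

theorem Holds.below_cons {Δ E : Multiset Formula} {o : Option Formula} {a c : Formula}
    (h : Holds (a ::ₘ Δ) o)
    (H : o = some c ∧ Δ = E ∨ o = none ∧ ∃ b, Δ = b ::ₘ E ∧ c = neg b) :
    Below (cls a * prod E) c := by
  rw [← prod_singleton]
  exact Holds.below (by simpa using h) H

theorem Holds.context {a : Formula} {Δ : Multiset Formula} {o : Option Formula}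
    (h : Holds (a ::ₘ Δ) o) : ¬(Δ = 0 ∧ o = none) := by
  rintro ⟨rfl, rfl⟩
  exact not_below_zero _ (holds_none_cons.1 h)

theorem holds_of_entails {Γ : Multiset Formula} {o : Option Formula} (h : Entails Γ o) :
    Holds Γ o := by
  induction h with
  | id a => simp [Holds, prod_singleton, below_cls, QG.id]
  | fus_right _ _ h k => simpa only [Holds, prod_add] using Below.mul h k
  | @fus_left Γ a b o hΓ _ h =>
    refine holds_left hΓ fun E c H => ?_
    have h' : Holds ({a, b} + Γ) o := by simpa using h
    simpa [prod, cls_fus] using h'.below H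
  | @res_right Γ a b hΓ _ h =>
    -- A nonempty product is the class of a formula, because a class times anything is never the
    -- adjoined unit.
    obtain ⟨g, hg⟩ := (eq_one_or_cls (prod Γ)).resolve_left fun e => by
      obtain ⟨b, hb⟩ := Multiset.exists_mem_of_ne_zero hΓ
      obtain ⟨E, rfl⟩ := Multiset.exists_cons_of_mem hb
      rw [prod_cons] at e
      obtain h | ⟨d, h⟩ := eq_one_or_cls (prod E) <;> rw [h] at e
      · exact WithOne.coe_ne_one ((mul_one _).symm.trans e)
      · exact WithOne.coe_ne_one e
    simp only [Holds, prod_cons, hg, ← cls_fus, below_cls] at *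
    exact res_intro h
  | @res_left Γ Δ a b o _ _ h k =>
    have key (F : Multiset Formula) (c : Formula) (hF : Below (cls b * prod F) c) :
        Below (cls (res a b) * (prod Γ * prod F)) c := by
      rw [← mul_assoc]
      refine Below.subst ?_ hF
      rw [mul_comm]
      exact (Below.mul h (below_cls.2 (id _))).trans (fus_res a b)
    cases o with
    | some c =>
      simp only [Holds, prod_cons, prod_add] at k ⊢
      exact key Δ c k
    | none =>
      -- The formula moved to the right comes from `Δ` rather than `Γ`, so that it also occurs in
      -- the premise containing `b`.
      obtain ⟨e, he⟩ := Multiset.exists_mem_of_ne_zero fun h => k.context ⟨h, rfl⟩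
      obtain ⟨F, rfl⟩ := Multiset.exists_cons_of_mem he
      rw [Multiset.cons_swap, holds_none_cons, prod_cons] at k
      rw [Multiset.add_cons, Multiset.cons_swap, holds_none_cons, prod_cons, prod_add]
      exact key F _ k
  | meet_right _ _ h k =>
    obtain ⟨g, hg, h⟩ := h
    simp only [Holds, hg, below_cls] at *
    exact meet_right h k
  | meet_left₁ _ h =>
    exact holds_left h.context fun E c H =>
      Below.subst (below_cls.2 (meet_left₁ (id _))) (h.below_cons H)
  | meet_left₂ _ h =>
    exact holds_left h.context fun E c H =>
      Below.subst (below_cls.2 (meet_left₂ (id _))) (h.below_cons H)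
  | join_right₁ _ h => exact Below.trans h (join_right₁ (id _))
  | join_right₂ _ h => exact Below.trans h (join_right₂ (id _))
  | join_left _ _ h k =>
    exact holds_left h.context fun E c H => (h.below_cons H).join (k.below_cons H)
  | neg_right _ h => exact holds_none_cons.1 h
  | neg_left _ h => exact holds_none_cons.2 (Below.trans h (le_neg_neg _))

theorem of_entails {a b : Formula} (h : Entails {a} (some b)) : QG a b := by
  simpa [Holds, prod_singleton, below_cls] using holds_of_entails h

end QG

/-! ### Cut elimination -/

namespace Entails

/-- The empty product is the adjoined unit, which lies below no formula; soundness therefore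
excludes empty antecedents. -/
theorem antecedent_ne_zero {Γ : Multiset Formula} {c : Formula} (h : Entails Γ (some c)) : Γ ≠ 0 :=
  (QG.holds_of_entails h).ne_zero

/-- The closure of a set of antecedents: those that can replace its members in every sequent. -/
def cl (X : Set (Multiset Formula)) : Set (Multiset Formula) :=
  -- Tests without succedent need a nonempty context, matching the side condition of `fus_left`.
  {Γ | Γ ≠ 0 ∧ ∀ Θ o, (o = none → Θ ≠ 0) → (∀ Δ ∈ X, Entails (Δ + Θ) o) → Entails (Γ + Θ) o}

theorem cl_mono {X Y : Set (Multiset Formula)} (h : X ⊆ Y) : cl X ⊆ cl Y :=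
  fun _ hΓ => ⟨hΓ.1, fun Θ o hΘ H => hΓ.2 Θ o hΘ fun Δ hΔ => H Δ (h hΔ)⟩

theorem cl_cl (X : Set (Multiset Formula)) : cl (cl X) ⊆ cl X :=
  fun _ hΓ => ⟨hΓ.1, fun Θ o hΘ H => hΓ.2 Θ o hΘ fun _ hΔ => hΔ.2 Θ o hΘ H⟩

theorem cl_subset {X Y : Set (Multiset Formula)} (hY : cl Y ⊆ Y) (h : X ⊆ Y) : cl X ⊆ Y :=
  (cl_mono h).trans hY

theorem subset_cl {X : Set (Multiset Formula)} {Γ : Multiset Formula} (h0 : Γ ≠ 0) (h : Γ ∈ X) :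
    Γ ∈ cl X := ⟨h0, fun _ _ _ H => H Γ h⟩

/-- The sums of members of two sets of antecedents. -/
def sums (X Y : Set (Multiset Formula)) : Set (Multiset Formula) :=
  {Γ | ∃ A ∈ X, ∃ B ∈ Y, Γ = A + B}

/-- The fixed part `C` is absorbed into the test context `Θ`, so the closure acts on one summand at
a time. -/
theorem cl_add {X Z : Set (Multiset Formula)} (hZ : cl Z ⊆ Z) {C : Multiset Formula}
    (h : ∀ A ∈ X, A + C ∈ Z) {A : Multiset Formula} (hA : A ∈ cl X) : A + C ∈ Z := by
  refine hZ ⟨fun e => hA.1 (add_eq_zero.1 e).1, fun Θ o hΘ H => ?_⟩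
  rw [add_assoc]
  refine hA.2 _ _ (fun ho e => hΘ ho (add_eq_zero.1 e).2) fun B hB => ?_
  rw [← add_assoc]
  exact H _ (h B hB)

/-- The interpretation of formulas as closed sets of antecedents. -/
def sem : Formula → Set (Multiset Formula)
  | var n => {Γ | Entails Γ (some (var n))}
  | neg a => {Γ | Γ ≠ 0 ∧ ∀ Δ ∈ sem a, Entails (Γ + Δ) none}
  | fus a b => cl (sums (sem a) (sem b))
  | res a b => {Γ | Γ ≠ 0 ∧ ∀ Δ ∈ sem a, Γ + Δ ∈ sem b}
  | meet a b => sem a ∩ sem b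
  | join a b => cl (sem a ∪ sem b)

theorem cl_entails (c : Formula) :
    cl {Γ | Entails Γ (some c)} ⊆ {Γ | Entails Γ (some c)} := fun Γ h => by
  simpa using h.2 0 (some c) (by simp) (by simp)

/-- Both properties go through one induction: closedness for a negation tests with contexts from
`sem a` and no succedent, which is allowed only if they are nonempty. -/
theorem sem_closed_ne_zero (a : Formula) : cl (sem a) ⊆ sem a ∧ ∀ Γ ∈ sem a, Γ ≠ 0 := by
  induction a with
  | var n => exact ⟨cl_entails _, fun Γ => antecedent_ne_zero⟩
  | neg a ih =>
    refine ⟨fun Γ h => ⟨h.1, fun Δ hΔ => ?_⟩, fun Γ h => h.1⟩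
    exact h.2 Δ none (fun _ => ih.2 Δ hΔ) fun E hE => hE.2 Δ hΔ
  | fus a b => exact ⟨cl_cl _, fun Γ h => h.1⟩
  | res a b iha ihb =>
    exact ⟨fun Γ h => ⟨h.1, fun Δ hΔ => cl_add ihb.1 (fun E hE => hE.2 Δ hΔ) h⟩, fun Γ h => h.1⟩
  | meet a b iha ihb =>
    exact ⟨fun Γ h => ⟨cl_subset iha.1 Set.inter_subset_left h,
      cl_subset ihb.1 Set.inter_subset_right h⟩, fun Γ h => iha.2 Γ h.1⟩
  | join a b => exact ⟨cl_cl _, fun Γ h => h.1⟩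

theorem sem_closed (a : Formula) : cl (sem a) ⊆ sem a := (sem_closed_ne_zero a).1

theorem sem_ne_zero {a : Formula} {Γ : Multiset Formula} (h : Γ ∈ sem a) : Γ ≠ 0 :=
  (sem_closed_ne_zero a).2 Γ h

theorem mem_fus {a b : Formula} {A B : Multiset Formula} (hA : A ∈ sem a) (hB : B ∈ sem b) :
    A + B ∈ sem (fus a b) :=
  subset_cl (fun e => sem_ne_zero hA (add_eq_zero.1 e).1) ⟨A, hA, B, hB, rfl⟩

theorem fus_subset {a b c : Formula} (h : ∀ A ∈ sem a, ∀ B ∈ sem b, A + B ∈ sem c) :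
    sem (fus a b) ⊆ sem c := by
  refine cl_subset (sem_closed c) ?_
  rintro _ ⟨A, hA, B, hB, rfl⟩
  exact h A hA B hB

theorem fus_add {a b c : Formula} {C : Multiset Formula}
    (h : ∀ A ∈ sem a, ∀ B ∈ sem b, A + B + C ∈ sem c) :
    ∀ A ∈ sem (fus a b), A + C ∈ sem c := fun A hA => by
  refine cl_add (sem_closed c) ?_ hA
  rintro _ ⟨A, hA, B, hB, rfl⟩
  exact h A hA B hB

/-- The closed sets form a model of the whole calculus, where cut is just transitivity of inclusion.
Contraposition holds because inconsistency of a sum does not depend on the order of its summands. -/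
theorem sem_mono {a b : Formula} (h : QG a b) : sem a ⊆ sem b := by
  induction h with
  | id => exact subset_rfl
  | assoc₁ a b c =>
    refine fus_subset fun D hD C hC => fus_add (fun A hA B hB => ?_) D hD
    rw [add_assoc]
    exact mem_fus hA (mem_fus hB hC)
  | assoc₂ a b c =>
    refine fus_subset fun A hA D hD => ?_
    rw [add_comm]
    refine fus_add (fun B hB C hC => ?_) D hD
    rw [add_comm, ← add_assoc]
    exact mem_fus (mem_fus hA hB) hC
  | comm a b =>
    refine fus_subset fun A hA B hB => ?_
    rw [add_comm]
    exact mem_fus hB hA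
  | res_intro _ h =>
    refine fun B hB => ⟨sem_ne_zero hB, fun A hA => ?_⟩
    rw [add_comm]
    exact h (mem_fus hA hB)
  | res_elim _ h =>
    refine fus_subset fun A hA B hB => ?_
    rw [add_comm]
    exact (h hB).2 A hA
  | meet_left₁ _ h => exact Set.inter_subset_left.trans h
  | meet_left₂ _ h => exact Set.inter_subset_right.trans h
  | meet_right _ _ h k => exact Set.subset_inter h k
  | join_left _ _ h k => exact cl_subset (sem_closed _) (Set.union_subset h k)
  | join_right₁ _ h => exact fun Γ hΓ => subset_cl (sem_ne_zero hΓ) (Or.inl (h hΓ))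
  | join_right₂ _ h => exact fun Γ hΓ => subset_cl (sem_ne_zero hΓ) (Or.inr (h hΓ))
  | smn _ h =>
    refine fus_subset fun C hC B hB =>
      ⟨fun e => sem_ne_zero hC (add_eq_zero.1 e).1, fun A hA => ?_⟩
    rw [add_assoc, add_comm, add_comm B]
    exact (h (mem_fus hA hB)).2 C hC
  | mn _ h =>
    refine fun C hC => ⟨sem_ne_zero hC, fun A hA => ?_⟩
    rw [add_comm]
    exact (h hA).2 C hC
  | cut _ _ h k => exact h.trans k

/-- Left rules give the first half and right rules the second. The halves need a joint induction
because negation and residual are contravariant in their first argument. Closedness of `sem b`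
reduces a membership to sequents in which `{b}` has been replaced. -/
theorem sem_adequate (a : Formula) :
    {a} ∈ sem a ∧ ∀ Γ ∈ sem a, Entails Γ (some a) := by
  induction a with
  | var n => exact ⟨id _, fun Γ h => h⟩
  | neg a ih =>
    refine ⟨⟨by simp, fun Δ hΔ => ?_⟩, fun Γ h => ?_⟩
    · exact neg_left (ih.2 Δ hΔ)
    · have := h.2 _ ih.1
      rw [add_comm] at this
      exact neg_right this
  | fus a b iha ihb =>
    refine ⟨⟨by simp, fun Θ o hΘ H => ?_⟩, cl_subset (cl_entails _) ?_⟩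
    · refine fus_left (fun h => hΘ h.2 h.1) ?_
      simpa using H _ ⟨_, iha.1, _, ihb.1, rfl⟩
    · rintro _ ⟨A, hA, B, hB, rfl⟩
      exact fus_right (iha.2 A hA) (ihb.2 B hB)
  | res a b iha ihb =>
    refine ⟨⟨by simp, fun Δ hΔ => sem_closed b ⟨by simp, fun Θ o hΘ H => ?_⟩⟩, fun Γ h => ?_⟩
    · rw [add_assoc]
      exact res_left (iha.2 Δ hΔ) (H _ ihb.1)
    · have := ihb.2 _ (h.2 _ iha.1)
      rw [add_comm] at this
      exact res_right h.1 this
  | meet a b iha ihb =>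
    refine ⟨⟨sem_closed a ⟨by simp, fun Θ o hΘ H => ?_⟩,
      sem_closed b ⟨by simp, fun Θ o hΘ H => ?_⟩⟩,
      fun Γ h => meet_right (iha.2 Γ h.1) (ihb.2 Γ h.2)⟩
    · exact meet_left₁ (H _ iha.1)
    · exact meet_left₂ (H _ ihb.1)
  | join a b iha ihb =>
    refine ⟨⟨by simp, fun Θ o hΘ H => ?_⟩, cl_subset (cl_entails _) ?_⟩
    · exact join_left (H _ (Or.inl iha.1)) (H _ (Or.inr ihb.1))
    · rintro Γ (h | h)
      · exact join_right₁ (iha.2 Γ h)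
      · exact join_right₂ (ihb.2 Γ h)

end Entails

/-- For completeness, `{a} ∈ sem a ⊆ sem b`, and members of `sem b` entail `b` without cut. -/
theorem entails_iff_QG {a b : Formula} : Entails {a} (some b) ↔ QG a b :=
  ⟨QG.of_entails, fun h =>
    (Entails.sem_adequate b).2 _ (Entails.sem_mono h (Entails.sem_adequate a).1)⟩

/-! ### Terminating proof search -/

/-- Derivability from rules: `prem s` lists the premises of each rule instance with
conclusion `s`. -/
inductive Derivable {σ : Type*} (prem : σ → List (List σ)) : σ → Prop
  | intro {s : σ} {ps : List σ} : ps ∈ prem s → (∀ p ∈ ps, Derivable prem p) → Derivable prem s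

namespace ProofSearch

variable {σ : Type*} (prem : σ → List (List σ))

/-- Replace the first goal of each list of goals by the premises of each possible rule. -/
def step (S : List (List σ)) : List (List σ) :=
  -- Alternatives form the outer list, and goals to be met jointly the inner ones. An empty goal
  -- list, which signals success, is kept unchanged.
  S.flatMap fun gs => List.casesOn gs [[]] fun g gs => (prem g).map (· ++ gs)

theorem exists_derivable_step (S : List (List σ)) :
    (∃ gs ∈ step prem S, ∀ g ∈ gs, Derivable prem g) → ∃ gs ∈ S, ∀ g ∈ gs, Derivable prem g := by
  rintro ⟨hs, hhs, H⟩
  obtain ⟨gs, hgs, h⟩ := List.mem_flatMap.1 hhs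
  refine ⟨gs, hgs, ?_⟩
  cases gs with
  | nil => simp
  | cons g gs =>
    obtain ⟨ps, hps, rfl⟩ := List.mem_map.1 h
    simp only [List.mem_append, or_imp, forall_and] at H
    simpa using ⟨.intro hps H.1, H.2⟩

theorem exists_derivable_of_iterate (n : ℕ) (S : List (List σ)) (h : [] ∈ (step prem)^[n] S) :
    ∃ gs ∈ S, ∀ g ∈ gs, Derivable prem g := by
  induction n generalizing S with
  | zero => exact ⟨[], h, by simp⟩
  | succ n ih => exact exists_derivable_step prem S (ih _ h)

variable {prem} {w : σ → ℕ}

/-- Replacing a goal of weight `w` by at most two of smaller weight costs at most `2 * 3 ^ (w - 1) <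
3 ^ w` when `w > 0`, so the potential drops. Base 2 would allow equality. -/
theorem exists_potential_step (H : ∀ s, ∀ ps ∈ prem s, ps.length ≤ 2 ∧ ∀ p ∈ ps, w p < w s)
    {n : ℕ} {S : List (List σ)}
    (h : ∃ gs ∈ S, (∀ g ∈ gs, Derivable prem g) ∧ (gs.map fun g => 3 ^ w g).sum ≤ n + 1) :
    ∃ gs ∈ step prem S, (∀ g ∈ gs, Derivable prem g) ∧ (gs.map fun g => 3 ^ w g).sum ≤ n := by
  obtain ⟨gs, hgs, hd, hn⟩ := h
  cases gs with
  | nil => exact ⟨[], List.mem_flatMap.2 ⟨[], hgs, by simp⟩, by simp, by simp⟩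
  | cons g gs =>
    simp only [List.mem_cons, forall_eq_or_imp] at hd
    obtain @⟨_, ps, hps, hp⟩ := hd.1
    refine ⟨ps ++ gs, List.mem_flatMap.2 ⟨_, hgs, List.mem_map.2 ⟨ps, hps, rfl⟩⟩, ?_, ?_⟩
    · simp only [List.mem_append]
      rintro x (hx | hx)
      exacts [hp x hx, hd.2 x hx]
    · simp only [List.map_cons, List.sum_cons, List.map_append, List.sum_append] at hn ⊢
      suffices (ps.map fun g => 3 ^ w g).sum < 3 ^ w g by omega
      obtain ⟨hl, hw⟩ := H g ps hps
      match ps, hl, hw with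
      | [], _, _ => simp
      | [p], _, hw => simpa using Nat.pow_lt_pow_right (a := 3) (by norm_num) (hw p (by simp))
      | [p, q], _, hw =>
        simp only [List.mem_cons, List.not_mem_nil, or_false, forall_eq_or_imp, forall_eq] at hw
        have hp := Nat.pow_le_pow_right (n := 3) (by norm_num) (Nat.succ_le_of_lt hw.1)
        have hq := Nat.pow_le_pow_right (n := 3) (by norm_num) (Nat.succ_le_of_lt hw.2)
        have := Nat.pow_pos (n := w p) (show 0 < 3 by norm_num)
        rw [pow_succ] at hp hq
        simp only [List.map_cons, List.map_nil, List.sum_cons, List.sum_nil]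
        omega

theorem mem_iterate (H : ∀ s, ∀ ps ∈ prem s, ps.length ≤ 2 ∧ ∀ p ∈ ps, w p < w s)
    (n : ℕ) (S : List (List σ))
    (h : ∃ gs ∈ S, (∀ g ∈ gs, Derivable prem g) ∧ (gs.map fun g => 3 ^ w g).sum ≤ n) :
    [] ∈ (step prem)^[n] S := by
  induction n generalizing S with
  | zero =>
    obtain ⟨gs, hgs, -, hn⟩ := h
    cases gs with
    | nil => exact hgs
    | cons g gs =>
      have := Nat.pow_pos (n := w g) (show 0 < 3 by norm_num)
      simp only [List.map_cons, List.sum_cons] at hn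
      omega
  | succ n ih => exact ih _ (exists_potential_step H h)

/-- The single goal `s` has potential `3 ^ w s`, so that many rounds suffice. The bounded
existential form fits the closure of primitive recursive predicates under quantification over lists.
-/
theorem derivable_iff (H : ∀ s, ∀ ps ∈ prem s, ps.length ≤ 2 ∧ ∀ p ∈ ps, w p < w s) (s : σ) :
    Derivable prem s ↔ ∃ gs ∈ (step prem)^[3 ^ w s] [[s]], gs = [] := by
  rw [exists_eq_right]
  refine ⟨fun h => mem_iterate H _ _ ⟨[s], by simp, by simpa, by simp⟩, fun h => ?_⟩
  simpa using exists_derivable_of_iterate prem _ _ h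

theorem primrec_step [Primcodable σ] (hprem : Primrec prem) : Primrec (step prem) := by
  have hrule : Primrec₂ fun (_ : List σ) (x : σ × List σ) => (prem x.1).map (· ++ x.2) :=
    Primrec.list_map (hprem.comp (Primrec.fst.comp Primrec.snd))
      (Primrec.list_append.comp Primrec.snd (Primrec.snd.comp (Primrec.snd.comp Primrec.fst)))
  exact Primrec.list_flatMap Primrec.id
    ((Primrec.list_casesOn Primrec.id (Primrec.const [[]]) hrule).comp Primrec.snd)

theorem primrec_derivable [Primcodable σ] (hprem : Primrec prem) (hw : Primrec w)
    (H : ∀ s, ∀ ps ∈ prem s, ps.length ≤ 2 ∧ ∀ p ∈ ps, w p < w s) :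
    PrimrecPred (Derivable prem) := by
  have hpow : Primrec₂ ((· ^ ·) : ℕ → ℕ → ℕ) := Primrec₂.unpaired'.1 Nat.Primrec.pow
  have hnil : PrimrecPred fun l : List σ => l = [] := by
    classical exact Primrec.eq.comp Primrec.id (Primrec.const [])
  refine PrimrecPred.of_eq (hnil.exists_mem_list.comp (Primrec.nat_iterate
    (hpow.comp (Primrec.const 3) hw) (Primrec.list_cons.comp
      (Primrec.list_cons.comp Primrec.id (Primrec.const [])) (Primrec.const []))
    ((primrec_step hprem).comp Primrec.snd).to₂)) fun s => (derivable_iff H s).symm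

end ProofSearch

/-! ### The rules on lists -/

/-- All ways to distribute the members of a list over two lists. -/
def splits {α : Type*} (l : List α) : List (List α × List α) :=
  l.foldr (fun x s => s.map (fun p => (x :: p.1, p.2)) ++ s.map fun p => (p.1, x :: p.2))
    [([], [])]

theorem coe_add_coe_of_mem_splits {α : Type*} {l : List α} {p : List α × List α}
    (h : p ∈ splits l) : (p.1 + p.2 : Multiset α) = l := by
  induction l generalizing p with
  | nil =>
    obtain rfl : p = ([], []) := by simpa [splits] using h
    rfl
  | cons x l ih =>
    simp only [splits, List.foldr_cons, List.mem_append, List.mem_map] at h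
    obtain ⟨q, hq, rfl⟩ | ⟨q, hq, rfl⟩ := h
    · simp only [← Multiset.cons_coe, ← ih hq, Multiset.cons_add]
    · simp only [← Multiset.cons_coe, ← ih hq, Multiset.add_cons]

theorem exists_mem_splits {α : Type*} {l : List α} {A B : Multiset α}
    (h : A + B = l) : ∃ p ∈ splits l, (p.1 : Multiset α) = A ∧ (p.2 : Multiset α) = B := by
  induction l generalizing A B with
  | nil =>
    obtain ⟨rfl, rfl⟩ := add_eq_zero.1 (h.trans Multiset.coe_nil)
    exact ⟨([], []), by simp [splits], rfl, rfl⟩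
  | cons x l ih =>
    simp only [splits, List.foldr_cons, List.mem_append, List.mem_map]
    rw [← Multiset.cons_coe] at h
    have hx : x ∈ A + B := h ▸ Multiset.mem_cons_self x _
    obtain hx | hx := Multiset.mem_add.1 hx <;> obtain ⟨C, rfl⟩ := Multiset.exists_cons_of_mem hx
    · rw [Multiset.cons_add, Multiset.cons_inj_right] at h
      obtain ⟨p, hp, rfl, rfl⟩ := ih h
      exact ⟨_, Or.inl ⟨p, hp, rfl⟩, rfl, rfl⟩
    · rw [Multiset.add_cons, Multiset.cons_inj_right] at h
      obtain ⟨p, hp, rfl, rfl⟩ := ih h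
      exact ⟨_, Or.inr ⟨p, hp, rfl⟩, rfl, rfl⟩

/-- Sequents with a list of antecedents. -/
abbrev ListSequent := List Formula × Option Formula

/-- The premises of right rules with antecedents `Γ` and the given principal formula. -/
def rightPremises (Γ : List Formula) : Formula → List (List ListSequent)
  | var _ => []
  | neg a => [[(a :: Γ, none)]]
  | fus a b => (splits Γ).map fun p => [(p.1, some a), (p.2, some b)]
  | res a b => if Γ = [] then [] else [[(a :: Γ, some b)]]
  | meet a b => [[(Γ, some a), (Γ, some b)]]
  | join a b => [[(Γ, some a)], [(Γ, some b)]]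

/-- The premises of left rules with context `s` and the given principal formula. -/
def leftPremises (s : ListSequent) : Formula → List (List ListSequent)
  | var _ => []
  | neg a => if s.2 = none then [[(s.1, some a)]] else []
  | fus a b => if s = ([], none) then [] else [[(a :: b :: s.1, s.2)]]
  | res a b => (splits s.1).map fun p => [(p.1, some a), (b :: p.2, s.2)]
  | meet a b => [[(a :: s.1, s.2)], [(b :: s.1, s.2)]]
  | join a b => [[(a :: s.1, s.2), (b :: s.1, s.2)]]

/-- The premises of all rule instances with a given conclusion. -/
def premises (s : ListSequent) : List (List ListSequent) :=
  -- The test recognises an axiom; `[[]]` is one rule instance without premises.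
  (if s.1.map some = [s.2] then [[]] else []) ++
    (s.2.toList.flatMap (rightPremises s.1) ++
      -- A split whose first part is a singleton selects the principal formula `x` and leaves the
      -- context `p.2`.
      (splits s.1).flatMap fun p => p.1.flatMap fun x =>
        if p.1 = [x] then leftPremises (p.2, s.2) x else [])

theorem right_mem_premises {Γ : List Formula} {c : Formula} {ps : List ListSequent}
    (h : ps ∈ rightPremises Γ c) : ps ∈ premises (Γ, some c) := by
  simp [premises, h]

theorem left_mem_premises {Γ : List Formula} {Δ : Multiset Formula} {a : Formula}
    (o : Option Formula) (h : a ::ₘ Δ = Γ) :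
    ∃ l : List Formula, (l : Multiset Formula) = Δ ∧
      ∀ ps ∈ leftPremises (l, o) a, ps ∈ premises (Γ, o) := by
  obtain ⟨⟨p, q⟩, hp, h₁, rfl⟩ := exists_mem_splits (A := {a}) (B := Δ) (l := Γ) (by simpa using h)
  obtain rfl : p = [a] := by simpa using h₁
  refine ⟨q, rfl, fun ps hps => ?_⟩
  simp only [premises, List.mem_append, List.mem_flatMap]
  exact Or.inr (Or.inr ⟨_, hp, a, by simp, by simpa using hps⟩)

theorem mem_premises {s : ListSequent} {ps : List ListSequent} (h : ps ∈ premises s) :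
    (ps = [] ∧ ∃ a, s = ([a], some a)) ∨ (∃ c, s.2 = some c ∧ ps ∈ rightPremises s.1 c) ∨
      ∃ (l : List Formula) (a : Formula), (s.1 : Multiset Formula) = a ::ₘ (l : Multiset Formula) ∧
        ps ∈ leftPremises (l, s.2) a := by
  simp only [premises, List.mem_append, List.mem_flatMap, Option.mem_toList] at h
  obtain h | ⟨c, hc, h⟩ | ⟨p, hp, a, -, h⟩ := h
  · left
    obtain ⟨Γ, o⟩ := s
    split_ifs at h with e
    · match Γ, e with
      | [a], e => exact ⟨by simpa using h, a, by simpa using e.symm⟩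
    · simp at h
  · exact Or.inr (Or.inl ⟨c, hc, h⟩)
  · split_ifs at h with e
    · refine Or.inr (Or.inr ⟨p.2, a, ?_, h⟩)
      rw [← coe_add_coe_of_mem_splits hp, e, Multiset.coe_singleton, Multiset.singleton_add]
    · simp at h

/-- The list calculus has no exchange rule, so the induction must cover every ordering of the
antecedents. -/
theorem derivable_of_entails {Γ : Multiset Formula} {o : Option Formula} (h : Entails Γ o) :
    ∀ l : List Formula, (l : Multiset Formula) = Γ → Derivable premises (l, o) := by
  induction h with
  | id a =>
    intro l hl
    obtain rfl : l = [a] := by simpa using hl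
    exact .intro (ps := []) (by simp [premises]) (by simp)
  | fus_right _ _ h k =>
    intro l hl
    obtain ⟨p, hp, e, e'⟩ := exists_mem_splits hl.symm
    refine .intro (right_mem_premises (List.mem_map.2 ⟨p, hp, rfl⟩)) ?_
    simpa using ⟨h _ e, k _ e'⟩
  | @fus_left Γ a b o hΓ _ h =>
    intro l hl
    obtain ⟨r, rfl, H⟩ := left_mem_premises o hl.symm
    refine .intro (H [(a :: b :: r, o)] ?_) ?_
    · have : ¬ (r, o) = ([], none) := by simpa using hΓ
      simp [leftPremises, this]
    · simpa using h _ rfl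
  | @res_right Γ a b hΓ _ h =>
    rintro l rfl
    refine .intro (ps := [(a :: l, some b)]) (right_mem_premises ?_) (by simpa using h _ rfl)
    have : l ≠ [] := by simpa using hΓ
    simp [rightPremises, this]
  | @res_left Γ Δ a b o _ _ h k =>
    intro l hl
    obtain ⟨r, hr, H⟩ := left_mem_premises o hl.symm
    obtain ⟨p, hp, e, e'⟩ := exists_mem_splits hr.symm
    refine .intro (H _ (List.mem_map.2 ⟨p, hp, rfl⟩)) ?_
    simpa using ⟨h _ e, k (b :: p.2) (by rw [← e']; rfl)⟩
  | @meet_right Γ a b _ _ h k =>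
    rintro l rfl
    refine .intro (ps := [(l, some a), (l, some b)])
      (right_mem_premises (by simp [rightPremises])) ?_
    simpa using ⟨h _ rfl, k _ rfl⟩
  | @meet_left₁ Γ a b o _ h =>
    intro l hl
    obtain ⟨r, rfl, H⟩ := left_mem_premises o hl.symm
    exact .intro (H [(a :: r, o)] (by simp [leftPremises])) (by simpa using h _ rfl)
  | @meet_left₂ Γ a b o _ h =>
    intro l hl
    obtain ⟨r, rfl, H⟩ := left_mem_premises o hl.symm
    exact .intro (H [(b :: r, o)] (by simp [leftPremises])) (by simpa using h _ rfl)
  | @join_right₁ Γ a b _ h =>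
    rintro l rfl
    exact .intro (ps := [(l, some a)]) (right_mem_premises (by simp [rightPremises]))
      (by simpa using h _ rfl)
  | @join_right₂ Γ a b _ h =>
    rintro l rfl
    exact .intro (ps := [(l, some b)]) (right_mem_premises (by simp [rightPremises]))
      (by simpa using h _ rfl)
  | @join_left Γ a b o _ _ h k =>
    intro l hl
    obtain ⟨r, rfl, H⟩ := left_mem_premises o hl.symm
    refine .intro (H [(a :: r, o), (b :: r, o)] (by simp [leftPremises])) ?_
    simpa using ⟨h _ rfl, k _ rfl⟩
  | @neg_right Γ a _ h =>
    rintro l rfl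
    exact .intro (ps := [(a :: l, none)]) (right_mem_premises (by simp [rightPremises]))
      (by simpa using h _ rfl)
  | @neg_left Γ a _ h =>
    intro l hl
    obtain ⟨r, rfl, H⟩ := left_mem_premises none hl.symm
    exact .intro (H [(r, some a)] (by simp [leftPremises])) (by simpa using h _ rfl)

theorem entails_of_right {Γ : List Formula} {c : Formula} {ps : List ListSequent}
    (h : ps ∈ rightPremises Γ c) (H : ∀ p ∈ ps, Entails p.1 p.2) : Entails Γ (some c) := by
  cases c with
  | var n => simp [rightPremises] at h
  | neg a =>
    obtain rfl : ps = _ := by simpa [rightPremises] using h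
    exact .neg_right (by simpa using H)
  | fus a b =>
    obtain ⟨p, hp, rfl⟩ := List.mem_map.1 h
    simp only [List.mem_cons, List.not_mem_nil, or_false, forall_eq_or_imp, forall_eq] at H
    rw [← coe_add_coe_of_mem_splits hp]
    exact .fus_right H.1 H.2
  | res a b =>
    obtain ⟨hΓ, rfl⟩ : Γ ≠ [] ∧ ps = [(a :: Γ, some b)] := by
      dsimp only [rightPremises] at h
      split_ifs at h with hΓ
      · simp at h
      · exact ⟨hΓ, by simpa using h⟩
    exact .res_right (by simpa using hΓ) (by simpa using H)
  | meet a b =>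
    obtain rfl : ps = _ := by simpa [rightPremises] using h
    simp only [List.mem_cons, List.not_mem_nil, or_false, forall_eq_or_imp, forall_eq] at H
    exact .meet_right H.1 H.2
  | join a b =>
    obtain rfl | rfl : ps = _ ∨ ps = _ := by simpa [rightPremises] using h
    · exact .join_right₁ (by simpa using H)
    · exact .join_right₂ (by simpa using H)

theorem entails_of_left {l : List Formula} {a : Formula} {o : Option Formula}
    {ps : List ListSequent} (h : ps ∈ leftPremises (l, o) a)
    (H : ∀ p ∈ ps, Entails p.1 p.2) : Entails (a ::ₘ (l : Multiset Formula)) o := by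
  cases a with
  | var n => simp [leftPremises] at h
  | neg a =>
    obtain ⟨rfl, rfl⟩ : o = none ∧ ps = [(l, some a)] := by
      dsimp only [leftPremises] at h
      split_ifs at h with ho
      · exact ⟨ho, by simpa using h⟩
      · simp at h
    exact .neg_left (by simpa using H)
  | fus a b =>
    obtain ⟨hl, rfl⟩ : ¬(l, o) = ([], none) ∧ ps = [(a :: b :: l, o)] := by
      dsimp only [leftPremises] at h
      split_ifs at h with hl
      · simp at h
      · exact ⟨hl, by simpa using h⟩
    exact .fus_left (by simpa using hl) (by simpa using H)
  | res a b =>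
    obtain ⟨p, hp, rfl⟩ := List.mem_map.1 h
    simp only [List.mem_cons, List.not_mem_nil, or_false, forall_eq_or_imp, forall_eq] at H
    rw [← coe_add_coe_of_mem_splits hp]
    exact .res_left H.1 H.2
  | meet a b =>
    obtain rfl | rfl : ps = _ ∨ ps = _ := by simpa [leftPremises] using h
    · exact .meet_left₁ (by simpa using H)
    · exact .meet_left₂ (by simpa using H)
  | join a b =>
    obtain rfl : ps = _ := by simpa [leftPremises] using h
    simp only [List.mem_cons, List.not_mem_nil, or_false, forall_eq_or_imp, forall_eq] at H
    exact .join_left H.1 H.2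

theorem entails_of_derivable {s : ListSequent} (h : Derivable premises s) :
    Entails s.1 s.2 := by
  induction h with
  | @intro s ps hps _ H =>
    obtain ⟨-, a, rfl⟩ | ⟨c, hc, h⟩ | ⟨l, a, e, h⟩ := mem_premises hps
    · exact .id a
    · exact hc ▸ entails_of_right h H
    · exact e ▸ entails_of_left h H

theorem derivable_iff_QG {a b : Formula} : Derivable premises ([a], some b) ↔ QG a b :=
  ⟨fun h => entails_iff_QG.1 (entails_of_derivable h),
    fun h => derivable_of_entails (entails_iff_QG.2 h) _ rfl⟩

/-! ### Termination -/

/-- A weight that decreases from conclusions to premises. -/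
def weight (s : ListSequent) : ℕ := (s.1.map toNat).sum + (s.2.map toNat).getD 0


theorem weight_mk_some (l : List Formula) (c : Formula) :
    weight (l, some c) = (l.map toNat).sum + c.toNat := rfl

theorem weight_mk_cons (a : Formula) (l : List Formula) (o : Option Formula) :
    weight (a :: l, o) = a.toNat + weight (l, o) := by
  simp [weight, add_assoc]

theorem weight_mk_none (l : List Formula) : weight (l, none) = (l.map toNat).sum := rfl

theorem weight_of_mem_splits {l : List Formula} {p : List Formula × List Formula}
    (h : p ∈ splits l) (o : Option Formula) : (p.1.map toNat).sum + weight (p.2, o) = weight (l, o) := by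
  have := congrArg (fun m : Multiset Formula => (m.map toNat).sum) (coe_add_coe_of_mem_splits h)
  simp only [Multiset.map_add, Multiset.sum_add, Multiset.map_coe, Multiset.sum_coe] at this
  simp [weight, ← this, add_assoc]

theorem sum_of_mem_splits {l : List Formula} {p : List Formula × List Formula}
    (h : p ∈ splits l) : (p.1.map toNat).sum + (p.2.map toNat).sum = (l.map toNat).sum :=
  weight_of_mem_splits h none

/-- Since `Nat.pair x y ≥ x + y`, the Gödel number of a binary compound exceeds the sum for its
arguments. No rule duplicates a formula within one premise, so Gödel numbers serve as sizes. -/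
theorem weight_of_mem_right {Γ : List Formula} {c : Formula} {ps : List ListSequent}
    (h : ps ∈ rightPremises Γ c) : ps.length ≤ 2 ∧ ∀ p ∈ ps, weight p < weight (Γ, some c) := by
  cases c with
  | var n => simp [rightPremises] at h
  | neg a =>
    obtain rfl : ps = _ := by simpa [rightPremises] using h
    simp [weight_mk_some, weight_mk_none, Formula.toNat]
    omega
  | fus a b =>
    have := Nat.add_le_pair a.toNat b.toNat
    obtain ⟨p, hp, rfl⟩ := List.mem_map.1 h
    have := sum_of_mem_splits hp
    simp [weight_mk_some, Formula.toNat]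
    omega
  | res a b =>
    have := Nat.add_le_pair a.toNat b.toNat
    dsimp only [rightPremises] at h
    split_ifs at h
    · simp at h
    · obtain rfl : ps = _ := by simpa using h
      simp [weight_mk_some, Formula.toNat]
      omega
  | meet a b =>
    have := Nat.add_le_pair a.toNat b.toNat
    obtain rfl : ps = _ := by simpa [rightPremises] using h
    simp [weight_mk_some, Formula.toNat]
    omega
  | join a b =>
    have := Nat.add_le_pair a.toNat b.toNat
    obtain rfl | rfl : ps = _ ∨ ps = _ := by simpa [rightPremises] using h
    all_goals
      simp [weight_mk_some, Formula.toNat]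
      omega

theorem weight_of_mem_left {l : List Formula} {o : Option Formula} {a : Formula}
    {ps : List ListSequent} (h : ps ∈ leftPremises (l, o) a) :
    ps.length ≤ 2 ∧ ∀ p ∈ ps, weight p < a.toNat + weight (l, o) := by
  cases a with
  | var n => simp [leftPremises] at h
  | neg a =>
    dsimp only [leftPremises] at h
    split_ifs at h with ho
    · obtain rfl : ps = _ := by simpa using h
      subst ho
      simp [weight_mk_some, weight_mk_none, Formula.toNat]
      omega
    · simp at h
  | fus a b =>
    have := Nat.add_le_pair a.toNat b.toNat
    dsimp only [leftPremises] at h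
    split_ifs at h
    · simp at h
    · obtain rfl : ps = _ := by simpa using h
      simp [weight_mk_cons, Formula.toNat]
      omega
  | res a b =>
    have := Nat.add_le_pair a.toNat b.toNat
    obtain ⟨p, hp, rfl⟩ := List.mem_map.1 h
    have : _ = weight (l, o) := weight_of_mem_splits hp o
    simp [weight_mk_some, weight_mk_cons, Formula.toNat]
    omega
  | meet a b =>
    have := Nat.add_le_pair a.toNat b.toNat
    obtain rfl | rfl : ps = _ ∨ ps = _ := by simpa [leftPremises] using h
    all_goals
      simp [weight_mk_cons, Formula.toNat]
      omega
  | join a b =>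
    have := Nat.add_le_pair a.toNat b.toNat
    obtain rfl : ps = _ := by simpa [leftPremises] using h
    simp [weight_mk_cons, Formula.toNat]
    omega

theorem weight_of_mem_premises (s : ListSequent) (ps : List ListSequent) (h : ps ∈ premises s) :
    ps.length ≤ 2 ∧ ∀ p ∈ ps, weight p < weight s := by
  obtain ⟨rfl, -⟩ | ⟨c, hc, h⟩ | ⟨l, a, e, h⟩ := mem_premises h
  · simp
  · obtain ⟨Γ, o⟩ := s
    obtain rfl : o = some c := hc
    exact weight_of_mem_right h
  · have : weight s = a.toNat + weight (l, s.2) := by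
      rw [← weight_mk_cons]
      have := congrArg (fun m : Multiset Formula => (m.map toNat).sum) e
      simp only [Multiset.map_cons, Multiset.sum_cons, Multiset.map_coe, Multiset.sum_coe] at this
      simp [weight, this]
    rw [this]
    exact weight_of_mem_left h

/-! ### Primitive recursiveness -/

namespace Formula

/-- The main connective, as a remainder of the Gödel number modulo 6. -/
def tag (a : Formula) : ℕ := a.toNat % 6

/-- The argument of a negation. -/
def arg (a : Formula) : Formula := ofNat (a.toNat / 6)

/-- The first argument of a binary connective. -/
def left (a : Formula) : Formula := ofNat (Nat.unpair (a.toNat / 6)).1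

/-- The second argument of a binary connective. -/
def right (a : Formula) : Formula := ofNat (Nat.unpair (a.toNat / 6)).2

theorem primrec_toNat : Primrec toNat := Primrec.of_equiv (e := equivNat)

theorem primrec_ofNat : Primrec ofNat := Primrec.of_equiv_symm (e := equivNat)

theorem primrec_tag : Primrec tag := Primrec.nat_mod.comp primrec_toNat (Primrec.const 6)

theorem primrec_quotient : Primrec fun a : Formula => a.toNat / 6 :=
  Primrec.nat_div.comp primrec_toNat (Primrec.const 6)

theorem primrec_arg : Primrec arg := primrec_ofNat.comp primrec_quotient

theorem primrec_left : Primrec left :=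
  primrec_ofNat.comp (Primrec.fst.comp (Primrec.unpair.comp primrec_quotient))

theorem primrec_right : Primrec right :=
  primrec_ofNat.comp (Primrec.snd.comp (Primrec.unpair.comp primrec_quotient))

/-- Definition by cases on the main connective preserves primitive recursiveness. -/
theorem primrec_cases {α τ : Type*} [Primcodable α] [Primcodable τ] {c : α → Formula}
    {F : α → Formula → τ} {x₀ : τ} {x₁ : α × Formula → τ}
    {x₂ x₃ x₄ x₅ : α × Formula × Formula → τ}
    (hc : Primrec c) (h₁ : Primrec x₁) (h₂ : Primrec x₂) (h₃ : Primrec x₃) (h₄ : Primrec x₄)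
    (h₅ : Primrec x₅) (f₀ : ∀ s n, F s (var n) = x₀) (f₁ : ∀ s a, F s (neg a) = x₁ (s, a))
    (f₂ : ∀ s a b, F s (fus a b) = x₂ (s, a, b)) (f₃ : ∀ s a b, F s (res a b) = x₃ (s, a, b))
    (f₄ : ∀ s a b, F s (meet a b) = x₄ (s, a, b)) (f₅ : ∀ s a b, F s (join a b) = x₅ (s, a, b)) :
    Primrec fun s => F s (c s) := by
  have hb : Primrec fun s => (s, (c s).left, (c s).right) :=
    Primrec.id.pair ((primrec_left.comp hc).pair (primrec_right.comp hc))
  have ht (n : ℕ) : PrimrecPred fun s => (c s).tag = n :=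
    Primrec.eq.comp (primrec_tag.comp hc) (Primrec.const n)
  -- Arguments are decoded arithmetically for every formula; the tests on the tag discard the
  -- meaningless values.
  refine Primrec.of_eq (Primrec.ite (ht 0) (Primrec.const x₀) <|
    Primrec.ite (ht 1) (h₁.comp (Primrec.id.pair (primrec_arg.comp hc))) <|
    Primrec.ite (ht 2) (h₂.comp hb) <| Primrec.ite (ht 3) (h₃.comp hb) <|
    Primrec.ite (ht 4) (h₄.comp hb) (h₅.comp hb)) fun s => ?_
  have hd (k r : ℕ) (hr : r < 6) : (6 * k + r) / 6 = k := by omega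
  cases c s <;>
    simp [tag, arg, left, right, toNat, Nat.add_mod, hd, ofNat_toNat, f₀, f₁, f₂, f₃, f₄, f₅]

end Formula

theorem primrec_splits {α : Type*} [Primcodable α] : Primrec (splits (α := α)) := by
  have hl : Primrec fun x : (List α × α × List (List α × List α)) × List α × List α =>
      (x.1.2.1 :: x.2.1, x.2.2) :=
    (Primrec.list_cons.comp (Primrec.fst.comp (Primrec.snd.comp Primrec.fst))
      (Primrec.fst.comp Primrec.snd)).pair (Primrec.snd.comp Primrec.snd)
  have hr : Primrec fun x : (List α × α × List (List α × List α)) × List α × List α =>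
      (x.2.1, x.1.2.1 :: x.2.2) :=
    (Primrec.fst.comp Primrec.snd).pair (Primrec.list_cons.comp
      (Primrec.fst.comp (Primrec.snd.comp Primrec.fst)) (Primrec.snd.comp Primrec.snd))
  exact Primrec.list_foldr Primrec.id (Primrec.const _) (Primrec.list_append.comp
    (Primrec.list_map (Primrec.snd.comp Primrec.snd) hl.to₂)
    (Primrec.list_map (Primrec.snd.comp Primrec.snd) hr.to₂)).to₂

theorem Primrec.list_singleton {α β : Type*} [Primcodable α] [Primcodable β] {f : α → β}
    (hf : Primrec f) : Primrec fun a => [f a] :=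
  Primrec.list_cons.comp hf (Primrec.const [])

theorem Primrec.list_pair {α β : Type*} [Primcodable α] [Primcodable β] {f g : α → β}
    (hf : Primrec f) (hg : Primrec g) : Primrec fun a => [f a, g a] :=
  Primrec.list_cons.comp hf hg.list_singleton

theorem primrec_rightPremises : Primrec₂ rightPremises := by
  have hΓ : Primrec fun x : (List Formula × Formula) × Formula × Formula => x.1.1 :=
    Primrec.fst.comp Primrec.fst
  have ha : Primrec fun x : (List Formula × Formula) × Formula × Formula => some x.2.1 :=
    Primrec.option_some.comp (Primrec.fst.comp Primrec.snd)
  have hb : Primrec fun x : (List Formula × Formula) × Formula × Formula => some x.2.2 :=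
    Primrec.option_some.comp (Primrec.snd.comp Primrec.snd)
  have h₁ : Primrec fun x : (List Formula × Formula) × Formula =>
      [[(x.2 :: x.1.1, (none : Option Formula))]] :=
    ((Primrec.list_cons.comp Primrec.snd (Primrec.fst.comp Primrec.fst)).pair
      (Primrec.const none)).list_singleton.list_singleton
  have h₂ : Primrec fun x : (List Formula × Formula) × Formula × Formula =>
      (splits x.1.1).map fun p => [(p.1, some x.2.1), (p.2, some x.2.2)] :=
    Primrec.list_map (primrec_splits.comp hΓ)
      (((Primrec.fst.comp Primrec.snd).pair (ha.comp Primrec.fst)).list_pair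
        ((Primrec.snd.comp Primrec.snd).pair (hb.comp Primrec.fst))).to₂
  have h₃ : Primrec fun x : (List Formula × Formula) × Formula × Formula =>
      if x.1.1 = [] then [] else [[(x.2.1 :: x.1.1, some x.2.2)]] :=
    Primrec.ite (Primrec.eq.comp hΓ (Primrec.const [])) (Primrec.const [])
      ((Primrec.list_cons.comp (Primrec.fst.comp Primrec.snd) hΓ).pair
        hb).list_singleton.list_singleton
  exact Formula.primrec_cases (F := fun s => rightPremises s.1) Primrec.snd h₁ h₂ h₃
    ((hΓ.pair ha).list_pair (hΓ.pair hb)).list_singleton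
    ((hΓ.pair ha).list_singleton.list_pair (hΓ.pair hb).list_singleton)
    (fun _ _ => rfl) (fun _ _ => rfl) (fun _ _ _ => rfl) (fun _ _ _ => rfl) (fun _ _ _ => rfl)
    (fun _ _ _ => rfl)

theorem primrec_leftPremises : Primrec₂ leftPremises := by
  have hs : Primrec fun x : (ListSequent × Formula) × Formula × Formula => x.1.1 :=
    Primrec.fst.comp Primrec.fst
  have ha : Primrec fun x : (ListSequent × Formula) × Formula × Formula => x.2.1 :=
    Primrec.fst.comp Primrec.snd
  have hb : Primrec fun x : (ListSequent × Formula) × Formula × Formula => x.2.2 :=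
    Primrec.snd.comp Primrec.snd
  have hcons {τ : Type} [Primcodable τ] {f : τ → Formula} {g : τ → ListSequent} (hf : Primrec f)
      (hg : Primrec g) : Primrec fun x => (f x :: (g x).1, (g x).2) :=
    (Primrec.list_cons.comp hf (Primrec.fst.comp hg)).pair (Primrec.snd.comp hg)
  have h₁ : Primrec fun x : (ListSequent × Formula) × Formula =>
      if x.1.1.2 = none then [[(x.1.1.1, some x.2)]] else [] :=
    Primrec.ite (Primrec.eq.comp (Primrec.snd.comp (Primrec.fst.comp Primrec.fst))
        (Primrec.const none))
      ((Primrec.fst.comp (Primrec.fst.comp Primrec.fst)).pair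
        (Primrec.option_some.comp Primrec.snd)).list_singleton.list_singleton
      (Primrec.const [])
  have h₂ : Primrec fun x : (ListSequent × Formula) × Formula × Formula =>
      if x.1.1 = ([], none) then [] else [[(x.2.1 :: x.2.2 :: x.1.1.1, x.1.1.2)]] :=
    Primrec.ite (Primrec.eq.comp hs (Primrec.const ([], none))) (Primrec.const [])
      (hcons ha (hcons hb hs)).list_singleton.list_singleton
  have h₃ : Primrec fun x : (ListSequent × Formula) × Formula × Formula =>
      (splits x.1.1.1).map fun p => [(p.1, some x.2.1), (x.2.2 :: p.2, x.1.1.2)] :=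
    Primrec.list_map (primrec_splits.comp (Primrec.fst.comp hs))
      (((Primrec.fst.comp Primrec.snd).pair
          (Primrec.option_some.comp (ha.comp Primrec.fst))).list_pair
        ((Primrec.list_cons.comp (hb.comp Primrec.fst) (Primrec.snd.comp Primrec.snd)).pair
          (Primrec.snd.comp (hs.comp Primrec.fst)))).to₂
  exact Formula.primrec_cases (F := fun s => leftPremises s.1) Primrec.snd h₁ h₂ h₃
    ((hcons ha hs).list_singleton.list_pair (hcons hb hs).list_singleton)
    ((hcons ha hs).list_pair (hcons hb hs)).list_singleton
    (fun _ _ => rfl) (fun _ _ => rfl) (fun _ _ _ => rfl) (fun _ _ _ => rfl) (fun _ _ _ => rfl)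
    (fun _ _ _ => rfl)

theorem primrec_premises : Primrec premises := by
  have hid : PrimrecPred fun s : ListSequent => s.1.map some = [s.2] :=
    Primrec.eq.comp (Primrec.list_map Primrec.fst (Primrec.option_some.comp Primrec.snd).to₂)
      (Primrec.snd.list_singleton)
  have hfocus : PrimrecPred fun x : (ListSequent × List Formula × List Formula) × Formula =>
      x.1.2.1 = [x.2] :=
    Primrec.eq.comp (Primrec.fst.comp (Primrec.snd.comp Primrec.fst)) Primrec.snd.list_singleton
  have hl : Primrec fun x : (ListSequent × List Formula × List Formula) × Formula =>
      leftPremises (x.1.2.2, x.1.1.2) x.2 :=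
    primrec_leftPremises.comp ((Primrec.snd.comp (Primrec.snd.comp Primrec.fst)).pair
      (Primrec.snd.comp (Primrec.fst.comp Primrec.fst))) Primrec.snd
  refine Primrec.list_append.comp (Primrec.ite hid (Primrec.const _) (Primrec.const _)) ?_
  refine Primrec.list_append.comp (Primrec.list_flatMap
    (Primrec.optionToList.comp Primrec.snd)
    (primrec_rightPremises.comp (Primrec.fst.comp Primrec.fst) Primrec.snd).to₂) ?_
  exact Primrec.list_flatMap (primrec_splits.comp Primrec.fst) (Primrec.list_flatMap
    (Primrec.fst.comp Primrec.snd) (Primrec.ite hfocus hl (Primrec.const [])).to₂).to₂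

theorem primrec_weight : Primrec weight := by
  have hsum : Primrec fun s : ListSequent => s.1.foldr (fun a n => a.toNat + n) 0 :=
    Primrec.list_foldr Primrec.fst (Primrec.const 0)
      (Primrec.nat_add.comp (Formula.primrec_toNat.comp (Primrec.fst.comp Primrec.snd))
        (Primrec.snd.comp Primrec.snd)).to₂
  refine (Primrec.nat_add.comp hsum (Primrec.option_getD.comp (Primrec.option_map Primrec.snd
    (Formula.primrec_toNat.comp Primrec.snd).to₂) (Primrec.const 0))).of_eq fun s => ?_
  simp [weight, List.sum, List.foldr_map]

/-- It is decidable whether a given sequent `α ⇒ β` is derivable in qG. -/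
theorem mainTheorem2 : ComputablePred (fun s : Formula × Formula => QG s.1 s.2) := by
  have h := (ProofSearch.primrec_derivable primrec_premises primrec_weight
    weight_of_mem_premises).comp (f := fun s : Formula × Formula => ([s.1], some s.2))
    (Primrec.fst.list_singleton.pair (Primrec.option_some.comp Primrec.snd))
  exact (h.of_eq fun _ => derivable_iff_QG).computablePred
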